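/- Let $H(x) = -x\log x-(1-x)\log(1-x)$ be the binary entropy on $[0,1]$ (natural logarithm, $0\log 0=0$). There is a unique $\alpha=\alpha_{3/2}\in(0,1)$ with $\alpha = (1+\alpha)^{-1/2}$. For integers $k\ge r\ge 1$ put $$h_{k,r}(x)=\sum_{j=0}^{k-1}x^{rj}\sum_{v=0}^{j}\frac{(-1)^{j-v}}{v+1}\binom{rv+k}{k}\binom{k}{j-v},$$ and let $$p_{3,2}(x)=3\,\alpha_{3/2}\,(1-x^2)^3\,h_{3,3}(x)-2\,(1-x^3)^3\,h_{3,2}(x).$$ Then $p_{3,2}$ has exactly two real roots in the open interval $(0,1)$, counted with multiplicity, and they are distinct. Moreover $$\alpha_{3/2}\,H(x^{3/2})\ \ge\ x^{1/2}H(x)\qquad\text{for all } 0\le x\le 1,$$ with equality at $x=0$, $x=\frac{1}{1+\alpha_{3/2}}$ and $x=1$. -/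

import Mathlib

open Polynomial

/-- `α` is a solution in `(0, 1)` of the functional equation `α = 1 / (1 + α) ^ (q - 1)`,
where the exponent `q` is real. -/
def IsEntropyConstant (q α : ℝ) : Prop :=
  0 < α ∧ α < 1 ∧ α = 1 / (1 + α) ^ (q - 1)

/-- The entropy polynomial
`h_{k,r}(x) = ∑_{j=0}^{k-1} x^{rj} ∑_{v=0}^{j} (-1)^{j-v}/(v+1) * C(rv+k,k) * C(k,j-v)`. -/
noncomputable def entropyPoly (k r : ℕ) : ℝ[X] :=
  ∑ j ∈ Finset.range k,
    C (∑ v ∈ Finset.range (j + 1),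
      (-1 : ℝ) ^ (j - v) / ((v : ℝ) + 1) * ((r * v + k).choose k : ℝ) * (k.choose (j - v) : ℝ))
      * X ^ (r * j)

/-- `p_{k,r}(x) = α k (1 - x^r)^k h_{k,k}(x) - r (1 - x^k)^k h_{k,r}(x)`, to be used with `α` the
solution of the functional equation for the exponent `q = k / r`. -/
noncomputable def rootPoly (k r : ℕ) (α : ℝ) : ℝ[X] :=
  C (α * (k : ℝ)) * (1 - X ^ r) ^ k * entropyPoly k k
    - C (r : ℝ) * (1 - X ^ k) ^ k * entropyPoly k r

/-! ### The entropy constant -/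

/-! Substituting `√x` for the variable turns the inequality into g ≥ 0 on [0, 1] for g(y) = α H(y³)
- y H(y²). The equation for α reads α² + α³ = 1, so 1 - α² = α³, 1 - α³ = α² and 1/(1 + α) = α²;
these identities give g(α) = g'(α) = 0, and g also vanishes at 0 and 1.

Differentiating four times removes every logarithm: g'''' is a nonvanishing factor times p on (0, 1)
(`hasDerivAt_entropyGapDeriv₃`). Since p has at most two roots there, Rolle's theorem bounds the
zeros of g' and forbids any zero of g in (0, 1) other than α (`entropyGap_ne_zero`). As g''(α) > 0,
g is nonnegative near α, and a negative value elsewhere would force another zero.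

For the root count, p = (1 - X)³ (αD - N), so its roots in (0, 1) are the points where N/D takes the
value α. The numerator W = N'D - ND' of (N/D)' has at most one positive root, so N/D takes α at most
twice; sign changes give two roots, and a double root would be a second root of W. -/

lemma rpow_three_halves_sub_one (y : ℝ) : y ^ ((3 / 2 : ℝ) - 1) = √y := by
  rw [Real.sqrt_eq_rpow]; norm_num

lemma isEntropyConstant_three_halves_iff {α : ℝ} :
    IsEntropyConstant (3 / 2) α ↔ 0 < α ∧ α < 1 ∧ α ^ 2 * (1 + α) = 1 := by
  unfold IsEntropyConstant
  refine and_congr_right fun h0 => and_congr_right fun _ => ?_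
  have h1 : 0 < 1 + α := by linarith
  have hs : 0 < √(1 + α) := Real.sqrt_pos.2 h1
  have hsq : √(1 + α) ^ 2 = 1 + α := Real.sq_sqrt h1.le
  rw [rpow_three_halves_sub_one, eq_div_iff hs.ne']
  constructor
  · intro h
    rw [← hsq, ← mul_pow, h, one_pow]
  · intro h
    rw [← hsq, ← mul_pow] at h
    exact (pow_eq_one_iff_of_nonneg (by positivity) two_ne_zero).1 h

/-- The increasing cubic t²(1 + t) is below 1 at 3/4 and above 1 at 189/250. The later numerical
estimates need nothing finer. -/
lemma entropyConstant_bounds {α : ℝ} (h0 : 0 < α) (h : α ^ 2 * (1 + α) = 1) :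
    3 / 4 < α ∧ α < 189 / 250 := by
  constructor <;> by_contra! hc <;> nlinarith [mul_pos h0 h0, mul_nonneg h0.le h0.le,
    mul_nonneg h0.le (sub_nonneg.2 hc), sq_nonneg α, mul_nonneg (sq_nonneg α) (sub_nonneg.2 hc)]

lemma existsUnique_entropyConstant : ∃! α : ℝ, IsEntropyConstant (3 / 2) α := by
  simp only [isEntropyConstant_three_halves_iff]
  have hcont : ContinuousOn (fun t : ℝ => t ^ 2 * (1 + t)) (Set.Icc 0 1) := by fun_prop
  obtain ⟨α, ⟨hα0, hα1⟩, hα⟩ := intermediate_value_Ioo (zero_le_one' ℝ) hcont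
    (show (1 : ℝ) ∈ _ by norm_num)
  refine ⟨α, ⟨hα0, hα1, hα⟩, fun β ⟨hβ0, hβ1, hβ⟩ => ?_⟩
  rcases lt_trichotomy α β with h | h | h
  · have : α ^ 2 * (1 + α) < β ^ 2 * (1 + β) := by gcongr
    simp only at hα; linarith
  · exact h.symm
  · have : β ^ 2 * (1 + β) < α ^ 2 * (1 + α) := by gcongr
    simp only at hα; linarith

/-! ### The roots of the polynomial -/

/-- The first part of the cofactor of `(1 - X) ^ 3` in `rootPoly 3 2 α`. -/
noncomputable def cofactorD : ℝ[X] := C 3 * (1 + X) ^ 3 * (1 + C 7 * X ^ 3 + X ^ 6)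

/-- The second part of the cofactor of `(1 - X) ^ 3` in `rootPoly 3 2 α`. -/
noncomputable def cofactorN : ℝ[X] :=
  C 2 * (1 + X + X ^ 2) ^ 3 * (1 + C 2 * X ^ 2 - C (1 / 3) * X ^ 4)

lemma entropyPoly_three_three : entropyPoly 3 3 = 1 + C 7 * X ^ 3 + X ^ 6 := by
  simp only [entropyPoly, Finset.sum_range_succ, Finset.sum_range_zero]
  norm_num [Nat.choose]

lemma entropyPoly_three_two :
    entropyPoly 3 2 = 1 + C 2 * X ^ 2 - C (1 / 3) * X ^ 4 := by
  simp only [entropyPoly, Finset.sum_range_succ, Finset.sum_range_zero]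
  norm_num [Nat.choose]
  rw [sub_eq_add_neg, ← neg_mul, ← C_neg]

lemma rootPoly_three_two (α : ℝ) :
    rootPoly 3 2 α = (1 - X) ^ 3 * (C α * cofactorD - cofactorN) := by
  rw [rootPoly, entropyPoly_three_three, entropyPoly_three_two, cofactorD, cofactorN]
  push_cast
  rw [C_mul]
  ring

lemma cofactorD_eval_pos {x : ℝ} (hx : 0 < x) : 0 < cofactorD.eval x := by
  simp only [cofactorD, eval_mul, eval_add, eval_pow, eval_X, eval_C, eval_one]
  positivity

/-- The Wronskian of the two parts of the cofactor. -/
noncomputable def cofactorWronskian : ℝ[X] :=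
  derivative cofactorN * cofactorD - cofactorN * derivative cofactorD

lemma cofactorWronskian_eval (x : ℝ) :
    cofactorWronskian.eval x = x * ((60 + 180 * x + 100 * x ^ 2) - x ^ 3 *
      (480 + 1632 * x + 2652 * x ^ 2 + 2556 * x ^ 3 + 1374 * x ^ 4 + 328 * x ^ 5 + 636 * x ^ 6
        + 1728 * x ^ 7 + 2158 * x ^ 8 + 1536 * x ^ 9 + 618 * x ^ 10 + 144 * x ^ 11
        + 36 * x ^ 12 + 12 * x ^ 13 + 2 * x ^ 14)) := by
  simp [cofactorWronskian, cofactorD, cofactorN, derivative_pow]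
  ring

/-- Descartes' rule with one sign change: at a positive root, 60/x³ + 180/x² + 100/x = S(x), whose
left side strictly decreases while S has positive coefficients. The proof compares both sides at a
and b after multiplying by a³b³. -/
lemma cofactorWronskian_root_unique {a b : ℝ} (ha : 0 < a) (hab : a < b)
    (hWa : cofactorWronskian.eval a = 0) (hWb : cofactorWronskian.eval b = 0) : False := by
  have hb : 0 < b := ha.trans hab
  rw [cofactorWronskian_eval, mul_eq_zero, or_iff_right ha.ne'] at hWa
  rw [cofactorWronskian_eval, mul_eq_zero, or_iff_right hb.ne'] at hWb
  set S : ℝ → ℝ := fun x => 480 + 1632 * x + 2652 * x ^ 2 + 2556 * x ^ 3 + 1374 * x ^ 4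
    + 328 * x ^ 5 + 636 * x ^ 6 + 1728 * x ^ 7 + 2158 * x ^ 8 + 1536 * x ^ 9 + 618 * x ^ 10
    + 144 * x ^ 11 + 36 * x ^ 12 + 12 * x ^ 13 + 2 * x ^ 14 with hS
  change 60 + 180 * a + 100 * a ^ 2 - a ^ 3 * S a = 0 at hWa
  change 60 + 180 * b + 100 * b ^ 2 - b ^ 3 * S b = 0 at hWb
  have hSab : S a ≤ S b := by simp only [hS]; gcongr
  have h3 : a ^ 3 < b ^ 3 := by gcongr
  have h2 : a ^ 3 * b < b ^ 3 * a := by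
    have : a ^ 2 < b ^ 2 := by gcongr
    nlinarith [mul_pos ha hb]
  have h1 : a ^ 3 * b ^ 2 < b ^ 3 * a ^ 2 := by
    have : 0 < a ^ 2 * b ^ 2 := by positivity
    nlinarith
  have key : a ^ 3 * (b ^ 3 * S b) < b ^ 3 * (a ^ 3 * S a) := by
    rw [show b ^ 3 * S b = 60 + 180 * b + 100 * b ^ 2 by linarith,
      show a ^ 3 * S a = 60 + 180 * a + 100 * a ^ 2 by linarith]
    linarith
  have : a ^ 3 * b ^ 3 * S a ≤ a ^ 3 * b ^ 3 * S b := by gcongr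
  linarith

section Cofactor

variable {α : ℝ}

lemma cofactor_root_iff {x : ℝ} :
    (C α * cofactorD - cofactorN).eval x = 0 ↔ cofactorN.eval x = α * cofactorD.eval x := by
  rw [eval_sub, eval_mul, eval_C, sub_eq_zero, eq_comm]

/-- Rolle's theorem for N/D, which equals α at both endpoints. Dividing by D eliminates α, so the
same W serves for every α. -/
lemma exists_wronskian_root {a b : ℝ} (ha : 0 < a) (hab : a < b)
    (hqa : (C α * cofactorD - cofactorN).eval a = 0)
    (hqb : (C α * cofactorD - cofactorN).eval b = 0) :
    ∃ c, a < c ∧ c < b ∧ cofactorWronskian.eval c = 0 := by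
  have hD : ∀ x, a ≤ x → cofactorD.eval x ≠ 0 := fun x hx =>
    (cofactorD_eval_pos (ha.trans_le hx)).ne'
  rw [cofactor_root_iff] at hqa hqb
  have hder : ∀ x, a ≤ x → HasDerivAt (fun x => cofactorN.eval x / cofactorD.eval x)
      (cofactorWronskian.eval x / cofactorD.eval x ^ 2) x := fun x hx => by
    refine ((cofactorN.hasDerivAt x).div (cofactorD.hasDerivAt x) (hD x hx)).congr_deriv ?_
    simp only [cofactorWronskian, eval_sub, eval_mul]
  obtain ⟨c, ⟨hac, hcb⟩, hc⟩ := exists_hasDerivAt_eq_zero hab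
    (fun x hx => (hder x hx.1).continuousAt.continuousWithinAt)
    (by rw [hqa, hqb, mul_div_cancel_right₀ _ (hD a le_rfl), mul_div_cancel_right₀ _ (hD b hab.le)])
    (fun x hx => hder x hx.1.le)
  refine ⟨c, hac, hcb, ?_⟩
  rwa [div_eq_zero_iff, or_iff_left (pow_ne_zero 2 (hD c hac.le))] at hc

lemma cofactor_not_three_roots {a b c : ℝ} (ha : 0 < a) (hab : a < b) (hbc : b < c)
    (hqa : (C α * cofactorD - cofactorN).eval a = 0)
    (hqb : (C α * cofactorD - cofactorN).eval b = 0)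
    (hqc : (C α * cofactorD - cofactorN).eval c = 0) : False := by
  obtain ⟨s, hs1, hs2, hs⟩ := exists_wronskian_root ha hab hqa hqb
  obtain ⟨t, ht1, _, ht⟩ := exists_wronskian_root (ha.trans hab) hbc hqb hqc
  exact cofactorWronskian_root_unique (ha.trans hs1) (hs2.trans ht1) hs ht

/-- At a double root N = αD and N' = αD', so N'D and ND' are both αDD'. -/
lemma wronskian_eq_zero_of_double_root {x : ℝ}
    (hq : (C α * cofactorD - cofactorN).eval x = 0)
    (hq' : (derivative (C α * cofactorD - cofactorN)).eval x = 0) :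
    cofactorWronskian.eval x = 0 := by
  simp only [derivative_sub, derivative_C_mul, eval_sub, eval_mul, eval_C] at hq hq'
  simp only [cofactorWronskian, eval_sub, eval_mul]
  linear_combination (-cofactorD.eval x) * hq' + (derivative cofactorD).eval x * hq

lemma exists_two_cofactor_roots (h1 : 3 / 4 < α) (h2 : α < 189 / 250) :
    ∃ a b : ℝ, 0 < a ∧ a < b ∧ b < 1 ∧ (C α * cofactorD - cofactorN).eval a = 0 ∧
      (C α * cofactorD - cofactorN).eval b = 0 := by
  -- N/D equals 2/3 at 0 and at 1 but is about 0.83 at 1/2, so αD - N has signs +, -, + at these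
  -- points.
  have h0 : 0 < (C α * cofactorD - cofactorN).eval 0 := by
    simp [cofactorD, cofactorN]; linarith
  have hm : (C α * cofactorD - cofactorN).eval (1 / 2) < 0 := by
    simp [cofactorD, cofactorN]; norm_num; linarith
  have he : 0 < (C α * cofactorD - cofactorN).eval 1 := by
    simp [cofactorD, cofactorN]; norm_num; linarith
  obtain ⟨a, ⟨ha0, ha1⟩, ha⟩ := intermediate_value_Ioo' (by norm_num : (0 : ℝ) ≤ 1 / 2)
    (C α * cofactorD - cofactorN).continuous.continuousOn (show (0 : ℝ) ∈ _ from ⟨hm, h0⟩)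
  obtain ⟨b, ⟨hb0, hb1⟩, hb⟩ := intermediate_value_Ioo (by norm_num : (1 / 2 : ℝ) ≤ 1)
    (C α * cofactorD - cofactorN).continuous.continuousOn (show (0 : ℝ) ∈ _ from ⟨hm, he⟩)
  exact ⟨a, b, ha0, ha1.trans hb0, hb1, ha, hb⟩

lemma rootPoly_roots_unitInterval (h1 : 3 / 4 < α) (h2 : α < 189 / 250) :
    ∃ x₁ x₂ : ℝ, x₁ < x₂ ∧
      Multiset.filter (fun x : ℝ => 0 < x ∧ x < 1) (rootPoly 3 2 α).roots = {x₁, x₂} := by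
  obtain ⟨a, b, ha, hab, hb, hqa, hqb⟩ := exists_two_cofactor_roots h1 h2
  refine ⟨a, b, hab, ?_⟩
  obtain ⟨c, hac, hcb, hc⟩ := exists_wronskian_root ha hab hqa hqb
  set q := C α * cofactorD - cofactorN with hq
  have hp : rootPoly 3 2 α = (1 - X) ^ 3 * q := rootPoly_three_two α
  have hroot : ∀ x : ℝ, x < 1 → ((rootPoly 3 2 α).eval x = 0 ↔ q.eval x = 0) := by
    intro x hx
    have : (1 - x) ^ 3 ≠ 0 := pow_ne_zero 3 (by linarith)
    simp [hp, this]
  -- The zero polynomial would make the cofactor vanish at any three chosen points of (0, 1).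
  have hp0 : rootPoly 3 2 α ≠ 0 := by
    intro h
    have hz : ∀ x : ℝ, x < 1 → q.eval x = 0 := fun x hx => (hroot x hx).1 (by simp [h])
    exact cofactor_not_three_roots (α := α) (a := 1 / 4) (b := 1 / 2) (c := 3 / 4)
      (by norm_num) (by norm_num) (by norm_num) (hz _ (by norm_num)) (hz _ (by norm_num))
      (hz _ (by norm_num))
  have hab_only : ∀ x, 0 < x → x < 1 → q.eval x = 0 → x = a ∨ x = b := by
    intro x hx0 hx1 hx
    by_contra! hne
    rcases lt_or_gt_of_ne hne.1 with h | h
    · exact cofactor_not_three_roots hx0 h hab hx hqa hqb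
    rcases lt_or_gt_of_ne hne.2 with h' | h'
    · exact cofactor_not_three_roots ha h h' hqa hx hqb
    · exact cofactor_not_three_roots ha hab h' hqa hqb hx
  have hsimple : ∀ x, 0 < x → x < 1 → (rootPoly 3 2 α).rootMultiplicity x ≤ 1 := by
    intro x hx0 hx1
    by_contra! hm
    rw [one_lt_rootMultiplicity_iff_isRoot hp0] at hm
    obtain ⟨hm1, hm2⟩ := hm
    have hqx : q.eval x = 0 := (hroot x hx1).1 hm1
    have hqx' : (derivative q).eval x = 0 := by
      have : (1 - x) ^ 3 ≠ 0 := pow_ne_zero 3 (by linarith)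
      simpa [hp, IsRoot, derivative_mul, hqx, this] using hm2
    -- The only candidates for a double root are a and b, but W already has its single positive root
    -- c strictly between them.
    have hW := wronskian_eq_zero_of_double_root hqx hqx'
    rcases hab_only x hx0 hx1 hqx with rfl | rfl
    · exact cofactorWronskian_root_unique ha hac hW hc
    · exact cofactorWronskian_root_unique (ha.trans hac) hcb hc hW
  refine (Multiset.Nodup.ext ?_ ?_).2 fun x => ?_
  · rw [Multiset.nodup_iff_count_le_one]
    intro x
    by_cases hx : 0 < x ∧ x < 1
    · rw [Multiset.count_filter_of_pos (p := fun x : ℝ => 0 < x ∧ x < 1) hx, count_roots]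
      exact hsimple x hx.1 hx.2
    · rw [Multiset.count_filter_of_neg (p := fun x : ℝ => 0 < x ∧ x < 1) hx]
      exact zero_le_one
  · simp [hab.ne]
  · simp only [Multiset.mem_filter, mem_roots hp0, IsRoot, Multiset.insert_eq_cons,
      Multiset.mem_cons, Multiset.mem_singleton]
    constructor
    · rintro ⟨hx, hx0, hx1⟩
      exact hab_only x hx0 hx1 ((hroot x hx1).1 hx)
    · rintro (rfl | rfl)
      · exact ⟨(hroot _ (hab.trans hb)).2 hqa, ha, hab.trans hb⟩
      · exact ⟨(hroot _ hb).2 hqb, ha.trans hab, hb⟩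

end Cofactor

/-! ### The entropy gap and its derivatives -/

/-- The closed form of `α * H (x ^ 3) - x * H (x ^ 2)`. -/
noncomputable def entropyGap (α x : ℝ) : ℝ :=
  -(3 * α - 2) * (x ^ 2 * (x * Real.log x)) - α * ((1 - x ^ 3) * Real.log (1 - x ^ 3))
    + x * ((1 - x ^ 2) * Real.log (1 - x ^ 2))

/-- The first derivative of `entropyGap α`. -/
noncomputable def entropyGapDeriv₁ (α x : ℝ) : ℝ :=
  -3 * (3 * α - 2) * (x * (x * Real.log x)) + 3 * α * x ^ 2 * Real.log (1 - x ^ 3)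
    + (1 - 3 * x ^ 2) * Real.log (1 - x ^ 2)

/-- The second derivative of `entropyGap α`. -/
noncomputable def entropyGapDeriv₂ (α x : ℝ) : ℝ :=
  -3 * (3 * α - 2) * (2 * (x * Real.log x) + x)
    + 3 * α * (2 * x * Real.log (1 - x ^ 3) - 3 * x ^ 4 / (1 - x ^ 3))
    - 6 * x * Real.log (1 - x ^ 2) - (2 * x - 6 * x ^ 3) / (1 - x ^ 2)

/-- The third derivative of `entropyGap α`. -/
noncomputable def entropyGapDeriv₃ (α x : ℝ) : ℝ :=
  -3 * (3 * α - 2) * (2 * Real.log x + 3)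
    + 3 * α * (2 * Real.log (1 - x ^ 3) - 6 * x ^ 3 / (1 - x ^ 3)
      - (12 * x ^ 3 - 3 * x ^ 6) / (1 - x ^ 3) ^ 2)
    - 6 * Real.log (1 - x ^ 2) + 12 * x ^ 2 / (1 - x ^ 2)
    - (2 - 16 * x ^ 2 + 6 * x ^ 4) / (1 - x ^ 2) ^ 2

lemma entropyGap_eq_binEntropy (α : ℝ) {x : ℝ} :
    entropyGap α x = α * Real.binEntropy (x ^ 3) - x * Real.binEntropy (x ^ 2) := by
  simp only [entropyGap, Real.binEntropy, Real.log_inv, Real.log_pow]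
  push_cast
  ring

lemma continuous_entropyGap (α : ℝ) : Continuous (entropyGap α) := by
  have h := Real.continuous_mul_log
  have h3 : Continuous fun x : ℝ => (1 - x ^ 3) * Real.log (1 - x ^ 3) :=
    h.comp (by fun_prop : Continuous fun x : ℝ => 1 - x ^ 3)
  have h2 : Continuous fun x : ℝ => (1 - x ^ 2) * Real.log (1 - x ^ 2) :=
    h.comp (by fun_prop : Continuous fun x : ℝ => 1 - x ^ 2)
  unfold entropyGap
  fun_prop

lemma one_sub_pow_pos {x : ℝ} (h0 : 0 ≤ x) (h1 : x < 1) {n : ℕ} (hn : n ≠ 0) : 0 < 1 - x ^ n :=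
  sub_pos.2 (pow_lt_one₀ h0 h1 hn)

/-- Keeping x log x as a unit gives continuity at 0, where Rolle's theorem will use an extra zero;
the point 1 is excluded because the other logarithms are singular there. -/
lemma continuousOn_entropyGapDeriv₁ (α : ℝ) :
    ContinuousOn (entropyGapDeriv₁ α) (Set.Ico 0 1) := by
  have h := Real.continuous_mul_log
  have h3 : ContinuousOn (fun x : ℝ => Real.log (1 - x ^ 3)) (Set.Ico 0 1) :=
    ContinuousOn.log (by fun_prop) fun x hx => (one_sub_pow_pos hx.1 hx.2 three_ne_zero).ne'
  have h2 : ContinuousOn (fun x : ℝ => Real.log (1 - x ^ 2)) (Set.Ico 0 1) :=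
    ContinuousOn.log (by fun_prop) fun x hx => (one_sub_pow_pos hx.1 hx.2 two_ne_zero).ne'
  unfold entropyGapDeriv₁
  fun_prop

lemma continuousOn_entropyGapDeriv₂ (α : ℝ) :
    ContinuousOn (entropyGapDeriv₂ α) (Set.Ico 0 1) := by
  have h := Real.continuous_mul_log
  have e3 : ∀ x ∈ Set.Ico (0 : ℝ) 1, 1 - x ^ 3 ≠ 0 :=
    fun x hx => (one_sub_pow_pos hx.1 hx.2 three_ne_zero).ne'
  have e2 : ∀ x ∈ Set.Ico (0 : ℝ) 1, 1 - x ^ 2 ≠ 0 :=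
    fun x hx => (one_sub_pow_pos hx.1 hx.2 two_ne_zero).ne'
  have h3 : ContinuousOn (fun x : ℝ => Real.log (1 - x ^ 3)) (Set.Ico 0 1) :=
    ContinuousOn.log (by fun_prop) e3
  have h2 : ContinuousOn (fun x : ℝ => Real.log (1 - x ^ 2)) (Set.Ico 0 1) :=
    ContinuousOn.log (by fun_prop) e2
  have d3 : ContinuousOn (fun x : ℝ => 3 * x ^ 4 / (1 - x ^ 3)) (Set.Ico 0 1) :=
    ContinuousOn.div (by fun_prop) (by fun_prop) e3
  have d2 : ContinuousOn (fun x : ℝ => (2 * x - 6 * x ^ 3) / (1 - x ^ 2)) (Set.Ico 0 1) :=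
    ContinuousOn.div (by fun_prop) (by fun_prop) e2
  unfold entropyGapDeriv₂
  fun_prop

section Derivatives

variable {x : ℝ}

lemma hasDerivAt_const_mul_pow (c x : ℝ) (n : ℕ) :
    HasDerivAt (fun x : ℝ => c * x ^ n) (c * (n * x ^ (n - 1))) x :=
  (hasDerivAt_pow n x).const_mul c

lemma hasDerivAt_one_sub_pow (n : ℕ) (x : ℝ) :
    HasDerivAt (fun x : ℝ => 1 - x ^ n) (-(n * x ^ (n - 1))) x :=
  (hasDerivAt_pow n x).const_sub 1

lemma hasDerivAt_log_one_sub_pow (h0 : 0 < x) (h1 : x < 1) {n : ℕ} (hn : n ≠ 0) :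
    HasDerivAt (fun x : ℝ => Real.log (1 - x ^ n)) (-(n * x ^ (n - 1)) / (1 - x ^ n)) x :=
  (hasDerivAt_one_sub_pow n x).log (one_sub_pow_pos h0.le h1 hn).ne'

lemma hasDerivAt_entropyGap (α : ℝ) (h0 : 0 < x) (h1 : x < 1) :
    HasDerivAt (entropyGap α) (entropyGapDeriv₁ α x) x := by
  have e2 := (one_sub_pow_pos h0.le h1 two_ne_zero).ne'
  have e3 := (one_sub_pow_pos h0.le h1 three_ne_zero).ne'
  have hl := (hasDerivAt_id x).mul (Real.hasDerivAt_log h0.ne')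
  have hA := ((hasDerivAt_pow 2 x).mul hl).const_mul (-(3 * α - 2))
  have hB := ((hasDerivAt_one_sub_pow 3 x).mul
    (hasDerivAt_log_one_sub_pow h0 h1 three_ne_zero)).const_mul α
  have hC := (hasDerivAt_id x).mul ((hasDerivAt_one_sub_pow 2 x).mul
    (hasDerivAt_log_one_sub_pow h0 h1 two_ne_zero))
  refine ((hA.sub hB).add hC).congr_deriv ?_
  simp only [entropyGapDeriv₁, id, Pi.mul_apply]
  push_cast
  field_simp
  ring

lemma hasDerivAt_entropyGapDeriv₁ (α : ℝ) (h0 : 0 < x) (h1 : x < 1) :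
    HasDerivAt (entropyGapDeriv₁ α) (entropyGapDeriv₂ α x) x := by
  have e2 := (one_sub_pow_pos h0.le h1 two_ne_zero).ne'
  have e3 := (one_sub_pow_pos h0.le h1 three_ne_zero).ne'
  have hl := (hasDerivAt_id x).mul (Real.hasDerivAt_log h0.ne')
  have hA := ((hasDerivAt_id x).mul hl).const_mul (-3 * (3 * α - 2))
  have hB := (hasDerivAt_const_mul_pow (3 * α) x 2).mul
    (hasDerivAt_log_one_sub_pow h0 h1 three_ne_zero)
  have hC := ((hasDerivAt_const_mul_pow 3 x 2).const_sub 1).mul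
    (hasDerivAt_log_one_sub_pow h0 h1 two_ne_zero)
  refine ((hA.add hB).add hC).congr_deriv ?_
  simp only [entropyGapDeriv₂, id, Pi.mul_apply]
  push_cast
  field_simp
  ring

lemma hasDerivAt_entropyGapDeriv₂ (α : ℝ) (h0 : 0 < x) (h1 : x < 1) :
    HasDerivAt (entropyGapDeriv₂ α) (entropyGapDeriv₃ α x) x := by
  have e2 := (one_sub_pow_pos h0.le h1 two_ne_zero).ne'
  have e3 := (one_sub_pow_pos h0.le h1 three_ne_zero).ne'
  have hl := (hasDerivAt_id x).mul (Real.hasDerivAt_log h0.ne')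
  have hA := ((hl.const_mul 2).add (hasDerivAt_id x)).const_mul (-3 * (3 * α - 2))
  have hB := ((((hasDerivAt_id x).const_mul 2).mul
    (hasDerivAt_log_one_sub_pow h0 h1 three_ne_zero)).sub
    ((hasDerivAt_const_mul_pow 3 x 4).div (hasDerivAt_one_sub_pow 3 x) e3)).const_mul (3 * α)
  have hC := ((hasDerivAt_id x).const_mul 6).mul
    (hasDerivAt_log_one_sub_pow h0 h1 two_ne_zero)
  have hD := (((hasDerivAt_id x).const_mul 2).sub (hasDerivAt_const_mul_pow 6 x 3)).div
    (hasDerivAt_one_sub_pow 2 x) e2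
  refine (((hA.add hB).sub hC).sub hD).congr_deriv ?_
  simp only [entropyGapDeriv₃, id, Pi.sub_apply]
  push_cast
  field_simp
  ring

/-- This is where p comes from: up to a factor without zeros on (0, 1), it is the fourth derivative
of the gap. -/
lemma hasDerivAt_entropyGapDeriv₃ (α : ℝ) (h0 : 0 < x) (h1 : x < 1) :
    HasDerivAt (entropyGapDeriv₃ α)
      (-6 * (rootPoly 3 2 α).eval x / (x * (1 - x ^ 3) ^ 3 * (1 - x ^ 2) ^ 3)) x := by
  have e2 := (one_sub_pow_pos h0.le h1 two_ne_zero).ne'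
  have e3 := (one_sub_pow_pos h0.le h1 three_ne_zero).ne'
  have hA := (((Real.hasDerivAt_log h0.ne').const_mul 2).add_const 3).const_mul
    (-3 * (3 * α - 2))
  have hB := ((((hasDerivAt_log_one_sub_pow h0 h1 three_ne_zero).const_mul 2).sub
    ((hasDerivAt_const_mul_pow 6 x 3).div (hasDerivAt_one_sub_pow 3 x) e3)).sub
    (((hasDerivAt_const_mul_pow 12 x 3).sub (hasDerivAt_const_mul_pow 3 x 6)).div
      ((hasDerivAt_one_sub_pow 3 x).pow 2) (pow_ne_zero 2 e3))).const_mul (3 * α)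
  have hC := (hasDerivAt_log_one_sub_pow h0 h1 two_ne_zero).const_mul 6
  have hD := (hasDerivAt_const_mul_pow 12 x 2).div (hasDerivAt_one_sub_pow 2 x) e2
  have hE := (((hasDerivAt_const_mul_pow 16 x 2).const_sub 2).add
    (hasDerivAt_const_mul_pow 6 x 4)).div
    ((hasDerivAt_one_sub_pow 2 x).pow 2) (pow_ne_zero 2 e2)
  refine ((((hA.add hB).sub hC).add hD).sub hE).congr_deriv ?_
  simp only [rootPoly, entropyPoly_three_three, entropyPoly_three_two, eval_sub, eval_mul,
    eval_add, eval_pow, eval_C, eval_X, eval_one, Pi.pow_apply, Pi.sub_apply, Pi.add_apply]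
  push_cast
  field_simp
  ring

end Derivatives

/-! ### Counting zeros -/

lemma exists_zero_of_hasDerivAt {f f' : ℝ → ℝ} (hf : ContinuousOn f (Set.Ico 0 1))
    (hff' : ∀ x, 0 < x → x < 1 → HasDerivAt f (f' x) x) {a b : ℝ} (ha : 0 ≤ a) (hab : a < b)
    (hb : b < 1) (hfa : f a = 0) (hfb : f b = 0) : ∃ c, a < c ∧ c < b ∧ f' c = 0 := by
  obtain ⟨c, hc, h⟩ := exists_hasDerivAt_eq_zero hab
    (hf.mono fun x hx => ⟨ha.trans hx.1, hx.2.trans_lt hb⟩) (hfa.trans hfb.symm)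
    (fun x hx => hff' x (ha.trans_lt hx.1) (hx.2.trans hb))
  exact ⟨c, hc.1, hc.2, h⟩

lemma rootPoly_cofactor_eval_eq_zero {α x : ℝ} (h0 : 0 < x) (h1 : x < 1)
    (h : -6 * (rootPoly 3 2 α).eval x / (x * (1 - x ^ 3) ^ 3 * (1 - x ^ 2) ^ 3) = 0) :
    (C α * cofactorD - cofactorN).eval x = 0 := by
  have e2 := (one_sub_pow_pos h0.le h1 two_ne_zero).ne'
  have e3 := (one_sub_pow_pos h0.le h1 three_ne_zero).ne'
  have e1 : (1 - x) ≠ 0 := by linarith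
  have hd : x * (1 - x ^ 3) ^ 3 * (1 - x ^ 2) ^ 3 ≠ 0 := by positivity
  rw [div_eq_zero_iff, or_iff_left hd, rootPoly_three_two] at h
  simpa [e1] using h

/-- Repeated Rolle. Since g' and g'' also vanish at 0, four zeros in (0, 1) persist for g'' and then
for g'''. The term log x in g''' is singular at 0, so the last step loses one zero, leaving three
roots of αD - N, one too many. -/
lemma entropyGapDeriv₁_not_four_zeros {α a b c d : ℝ} (ha : 0 < a) (hab : a < b) (hbc : b < c)
    (hcd : c < d) (hd : d < 1) (hfa : entropyGapDeriv₁ α a = 0) (hfb : entropyGapDeriv₁ α b = 0)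
    (hfc : entropyGapDeriv₁ α c = 0) (hfd : entropyGapDeriv₁ α d = 0) : False := by
  have hz₁ : entropyGapDeriv₁ α 0 = 0 := by simp [entropyGapDeriv₁]
  have hz₂ : entropyGapDeriv₂ α 0 = 0 := by simp [entropyGapDeriv₂]
  have R₁ := @exists_zero_of_hasDerivAt _ _ (continuousOn_entropyGapDeriv₁ α)
    (fun x => hasDerivAt_entropyGapDeriv₁ α)
  have R₂ := @exists_zero_of_hasDerivAt _ _ (continuousOn_entropyGapDeriv₂ α)
    (fun x => hasDerivAt_entropyGapDeriv₂ α)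
  have R₃ : ∀ s t : ℝ, 0 < s → s < t → t < 1 → entropyGapDeriv₃ α s = 0 →
      entropyGapDeriv₃ α t = 0 → ∃ u, s < u ∧ u < t ∧
        (C α * cofactorD - cofactorN).eval u = 0 := by
    intro s t hs hst ht hfs hft
    obtain ⟨u, hu, h⟩ := exists_hasDerivAt_eq_zero hst
      (fun x hx => (hasDerivAt_entropyGapDeriv₃ α (hs.trans_le hx.1)
        (hx.2.trans_lt ht)).continuousAt.continuousWithinAt) (hfs.trans hft.symm)
      (fun x hx => hasDerivAt_entropyGapDeriv₃ α (hs.trans hx.1) (hx.2.trans ht))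
    exact ⟨u, hu.1, hu.2, rootPoly_cofactor_eval_eq_zero (hs.trans hu.1) (hu.2.trans ht) h⟩
  obtain ⟨a₂, ha₂, ha₂', hfa₂⟩ := R₁ le_rfl ha (by linarith) hz₁ hfa
  obtain ⟨b₂, hb₂, hb₂', hfb₂⟩ := R₁ (by linarith) hab (by linarith) hfa hfb
  obtain ⟨c₂, hc₂, hc₂', hfc₂⟩ := R₁ (by linarith) hbc (by linarith) hfb hfc
  obtain ⟨d₂, hd₂, hd₂', hfd₂⟩ := R₁ (by linarith) hcd (by linarith) hfc hfd
  obtain ⟨a₃, ha₃, ha₃', hfa₃⟩ := R₂ le_rfl ha₂ (by linarith) hz₂ hfa₂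
  obtain ⟨b₃, hb₃, hb₃', hfb₃⟩ := R₂ (by linarith) (ha₂'.trans hb₂) (by linarith) hfa₂ hfb₂
  obtain ⟨c₃, hc₃, hc₃', hfc₃⟩ := R₂ (by linarith) (hb₂'.trans hc₂) (by linarith) hfb₂ hfc₂
  obtain ⟨d₃, hd₃, hd₃', hfd₃⟩ := R₂ (by linarith) (hc₂'.trans hd₂) (by linarith) hfc₂ hfd₂
  obtain ⟨a₄, ha₄, ha₄', hfa₄⟩ := R₃ _ _ ha₃ (ha₃'.trans hb₃) (by linarith) hfa₃ hfb₃
  obtain ⟨b₄, hb₄, hb₄', hfb₄⟩ := R₃ _ _ (by linarith) (hb₃'.trans hc₃) (by linarith) hfb₃ hfc₃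
  obtain ⟨c₄, hc₄, hc₄', hfc₄⟩ := R₃ _ _ (by linarith) (hc₃'.trans hd₃) (by linarith) hfc₃ hfd₃
  exact cofactor_not_three_roots (ha₃.trans ha₄) (ha₄'.trans hb₄) (hb₄'.trans hc₄) hfa₄ hfb₄ hfc₄

/-! ### Nonnegativity of the entropy gap -/

section Gap

variable {α : ℝ}

lemma one_sub_cube_entropyConstant (hα : α ^ 2 * (1 + α) = 1) : 1 - α ^ 3 = α ^ 2 := by
  linarith

lemma one_sub_sq_entropyConstant (hα : α ^ 2 * (1 + α) = 1) : 1 - α ^ 2 = α ^ 3 := by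
  linarith

lemma entropyGap_entropyConstant (hα : α ^ 2 * (1 + α) = 1) : entropyGap α α = 0 := by
  rw [entropyGap, one_sub_cube_entropyConstant hα, one_sub_sq_entropyConstant hα, Real.log_pow,
    Real.log_pow]
  push_cast
  ring

lemma entropyGapDeriv₁_entropyConstant (hα : α ^ 2 * (1 + α) = 1) :
    entropyGapDeriv₁ α α = 0 := by
  rw [entropyGapDeriv₁, one_sub_cube_entropyConstant hα, one_sub_sq_entropyConstant hα,
    Real.log_pow, Real.log_pow]
  push_cast
  linear_combination (-3 * Real.log α) * hα

lemma entropyGapDeriv₂_entropyConstant_pos (h0 : 0 < α) (hα : α ^ 2 * (1 + α) = 1) :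
    0 < entropyGapDeriv₂ α α := by
  obtain ⟨hl, hu⟩ := entropyConstant_bounds h0 hα
  have h1 : α < 1 := by linarith
  -- The inequality log t ≤ t - 1 is applied at t = √α, since at t = α it is too weak. Here
  -- (87/100)² exceeds 189/250, and 2(87/100 - 1) = -13/50.
  have hlog : Real.log α ≤ -(13 / 50) := by
    have := Real.log_le_sub_one_of_pos (show 0 < √α from Real.sqrt_pos.2 h0)
    rw [Real.log_sqrt h0.le] at this
    have h2 : √α ≤ 87 / 100 := by
      rw [Real.sqrt_le_left (by norm_num)]
      norm_num; linarith
    linarith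
  rw [entropyGapDeriv₂, one_sub_cube_entropyConstant hα, one_sub_sq_entropyConstant hα,
    Real.log_pow, Real.log_pow]
  have e₁ : 3 * α ^ 4 / α ^ 2 = 3 * α ^ 2 := by field_simp
  have e₂ : (2 * α - 6 * α ^ 3) / α ^ 3 = 2 * α - 4 := by
    rw [div_eq_iff (by positivity)]
    linear_combination -2 * α * hα
  rw [e₁, e₂]
  -- With α²(1 + α) = 1, the second derivative collapses to 4α - 5 - 6α(1 + α) log α. The bound on
  -- log α leaves a quadratic in α that is already positive at 3/4.
  have h3 : 0 < 6 * α * (1 + α) := by positivity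
  have h4 : 6 * α * (1 + α) * Real.log α ≤ 6 * α * (1 + α) * -(13 / 50) := by gcongr
  push_cast
  nlinarith

/-- Zeros of g at 0, y, α and 1 give three zeros of g' strictly between them; the fourth is α
itself, a double zero of g. -/
lemma entropyGap_ne_zero (h0 : 0 < α) (h1 : α < 1) (hα : α ^ 2 * (1 + α) = 1) {y : ℝ}
    (hy0 : 0 < y) (hy1 : y < 1) (hy : y ≠ α) : entropyGap α y ≠ 0 := by
  intro hgy
  have hz : entropyGap α 0 = 0 := by simp [entropyGap]
  have ho : entropyGap α 1 = 0 := by simp [entropyGap]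
  have hgα := entropyGap_entropyConstant hα
  have hgα' := entropyGapDeriv₁_entropyConstant hα
  have R : ∀ s t : ℝ, 0 ≤ s → s < t → t ≤ 1 → entropyGap α s = 0 → entropyGap α t = 0 →
      ∃ u, s < u ∧ u < t ∧ entropyGapDeriv₁ α u = 0 := by
    intro s t hs hst ht hfs hft
    obtain ⟨u, hu, h⟩ := exists_hasDerivAt_eq_zero hst (continuous_entropyGap α).continuousOn
      (hfs.trans hft.symm)
      (fun x hx => hasDerivAt_entropyGap α (hs.trans_lt hx.1) (hx.2.trans_le ht))
    exact ⟨u, hu.1, hu.2, h⟩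
  rcases lt_or_gt_of_ne hy with h | h
  · obtain ⟨a, ha, ha', hfa⟩ := R 0 y le_rfl hy0 hy1.le hz hgy
    obtain ⟨b, hb, hb', hfb⟩ := R y α hy0.le h h1.le hgy hgα
    obtain ⟨c, hc, hc', hfc⟩ := R α 1 h0.le h1 le_rfl hgα ho
    exact entropyGapDeriv₁_not_four_zeros ha (ha'.trans hb) hb' hc hc' hfa hfb hgα' hfc
  · obtain ⟨a, ha, ha', hfa⟩ := R 0 α le_rfl h0 h1.le hz hgα
    obtain ⟨b, hb, hb', hfb⟩ := R α y h0.le h hy1.le hgα hgy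
    obtain ⟨c, hc, hc', hfc⟩ := R y 1 hy0.le hy1 le_rfl hgy ho
    exact entropyGapDeriv₁_not_four_zeros ha ha' hb (hb'.trans hc) hc' hfa hgα' hfb hfc

lemma isLocalMin_entropyGap (h0 : 0 < α) (h1 : α < 1) (hα : α ^ 2 * (1 + α) = 1) :
    IsLocalMin (entropyGap α) α := by
  have hev : deriv (entropyGap α) =ᶠ[nhds α] entropyGapDeriv₁ α := by
    filter_upwards [Ioo_mem_nhds h0 h1] with x hx using (hasDerivAt_entropyGap α hx.1 hx.2).deriv
  refine isLocalMin_of_deriv_deriv_pos ?_ ?_ (continuous_entropyGap α).continuousAt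
  · rw [hev.deriv_eq, (hasDerivAt_entropyGapDeriv₁ α h0 h1).deriv]
    exact entropyGapDeriv₂_entropyConstant_pos h0 hα
  · rw [hev.eq_of_nhds, entropyGapDeriv₁_entropyConstant hα]

lemma entropyGap_nonneg (h0 : 0 < α) (h1 : α < 1) (hα : α ^ 2 * (1 + α) = 1) {y : ℝ}
    (hy0 : 0 ≤ y) (hy1 : y ≤ 1) : 0 ≤ entropyGap α y := by
  rcases hy0.eq_or_lt with rfl | hy0
  · simp [entropyGap]
  rcases hy1.eq_or_lt with rfl | hy1
  · simp [entropyGap]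
  by_contra! hneg
  have hgα := entropyGap_entropyConstant hα
  have hmin := isLocalMin_entropyGap h0 h1 hα
  rw [IsLocalMin, IsMinFilter, hgα, Metric.eventually_nhds_iff] at hmin
  obtain ⟨ε, hε, hmin⟩ := hmin
  have hcont := (continuous_entropyGap α).continuousOn (s := Set.univ)
  rcases lt_trichotomy y α with h | rfl | h
  · obtain ⟨z, hz, hzα⟩ := exists_between (max_lt h (by linarith : α - ε < α))
    obtain ⟨hyz, hεz⟩ := max_lt_iff.1 hz
    have hgz := hmin (y := z) (by rw [Real.dist_eq, abs_lt]; constructor <;> linarith)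
    obtain ⟨w, hw, hgw⟩ := intermediate_value_Icc hyz.le
      (hcont.mono (Set.subset_univ _)) ⟨hneg.le, hgz⟩
    exact entropyGap_ne_zero h0 h1 hα (hy0.trans_le hw.1) (by linarith [hw.2])
      (hw.2.trans_lt hzα).ne hgw
  · exact hneg.ne hgα
  · obtain ⟨z, hzα, hz⟩ := exists_between (lt_min h (by linarith : α < α + ε))
    obtain ⟨hyz, hεz⟩ := lt_min_iff.1 hz
    have hgz := hmin (y := z) (by rw [Real.dist_eq, abs_lt]; constructor <;> linarith)
    obtain ⟨w, hw, hgw⟩ := intermediate_value_Icc' hyz.le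
      (hcont.mono (Set.subset_univ _)) ⟨hneg.le, hgz⟩
    exact entropyGap_ne_zero h0 h1 hα (by linarith [hw.1]) (hw.2.trans_lt hy1)
      (hzα.trans_le hw.1).ne' hgw

end Gap

lemma rpow_three_halves_eq {x : ℝ} (hx : 0 ≤ x) : x ^ (3 / 2 : ℝ) = √x ^ 3 := by
  rw [Real.sqrt_eq_rpow, ← Real.rpow_natCast, ← Real.rpow_mul hx]; norm_num

lemma entropyGap_sqrt (α : ℝ) {x : ℝ} (hx : 0 ≤ x) : entropyGap α √x =
    α * Real.binEntropy (x ^ (3 / 2 : ℝ)) - x ^ (1 / 2 : ℝ) * Real.binEntropy x := by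
  rw [entropyGap_eq_binEntropy, Real.sq_sqrt hx, rpow_three_halves_eq hx, Real.sqrt_eq_rpow]

theorem mainTheorem6 :
    (∃! α : ℝ, IsEntropyConstant (3 / 2) α) ∧
    ∀ α : ℝ, IsEntropyConstant (3 / 2) α →
      -- the multiset of roots of `p_{3,2}` in `(0, 1)`, with multiplicity, is `{x₁, x₂}`
      (∃ x₁ x₂ : ℝ, x₁ < x₂ ∧
        Multiset.filter (fun x : ℝ => 0 < x ∧ x < 1) (rootPoly 3 2 α).roots = {x₁, x₂}) ∧
      (∀ x : ℝ, 0 ≤ x → x ≤ 1 →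
        x ^ (1 / 2 : ℝ) * Real.binEntropy x ≤ α * Real.binEntropy (x ^ (3 / 2 : ℝ))) ∧
      (∀ x : ℝ, x = 0 ∨ x = 1 / (1 + α) ∨ x = 1 →
        α * Real.binEntropy (x ^ (3 / 2 : ℝ)) = x ^ (1 / 2 : ℝ) * Real.binEntropy x) := by
  refine ⟨existsUnique_entropyConstant, fun α hα => ?_⟩
  obtain ⟨h0, h1, hα⟩ := isEntropyConstant_three_halves_iff.1 hα
  obtain ⟨hl, hu⟩ := entropyConstant_bounds h0 hα
  refine ⟨rootPoly_roots_unitInterval hl hu, fun x hx0 hx1 => ?_, fun x hx => ?_⟩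
  · rw [← sub_nonneg, ← entropyGap_sqrt α hx0]
    exact entropyGap_nonneg h0 h1 hα (Real.sqrt_nonneg x) (Real.sqrt_le_one.2 hx1)
  · have hinv : 1 / (1 + α) = α ^ 2 := by
      rw [eq_comm, eq_div_iff (by linarith), hα]
    rw [hinv] at hx
    have hx0 : 0 ≤ x := by
      rcases hx with rfl | rfl | rfl
      exacts [le_rfl, sq_nonneg α, zero_le_one]
    rw [← sub_eq_zero, ← entropyGap_sqrt α hx0]
    rcases hx with rfl | rfl | rfl
    · simp [entropyGap]
    · rw [Real.sqrt_sq h0.le, entropyGap_entropyConstant hα]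
    · simp [entropyGap]
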